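/- Let $N\ge 1$ be an integer, and let $\mathcal B_N$ be the set of all real $\beta$ with $0<\beta<\frac1{N+1}$ such that for every $n\ge 1$, all $i_1,\dots,i_n\in\{0,1,\dots,2N\}$ and all $j_1,\dots,j_n\in\{0,1,\dots,N\}$, the equality $\sum_{k=1}^n i_k\beta^k=\sum_{k=1}^n j_k\beta^k$ implies $i_k=j_k$ for all $1\le k\le n$. A set $K\subset\mathbb R$ is called self-similar if it is the attractor of a finite family of contractive similitudes $f_1,\dots,f_\ell$ of $\mathbb R$, i.e. $K$ is non-empty and compact and $K=\bigcup_{s=1}^{\ell} f_s(K)$, where $f_s(x)=\lambda_s x+a_s$ with $0<|\lambda_s|<1$ and $a_s\in\mathbb R$. Let $\beta\in\mathcal B_N$, and let $\Gamma$ be the attractor of the family $\big\{\phi_i(x)=\beta x+i\,\frac{1-\beta}{N}: i=0,1,\dots,N\big\}$. Then, for every $t>0$, the union $\Gamma\cup(\Gamma+t)$ is self-similar if and only if $$t=\frac{i(1-\beta)}{N}\,\beta^{-k}$$ for some $i\in\{1,2,\dots,\lfloor\frac{N+1}{2}\rfloor\}$ and some integer $k\ge 1$. -/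

import Mathlib

/-- A contractive similitude of the real line: `x ↦ r * x + a` with `0 < |r| < 1`
(orientation-reversing maps, `r < 0`, are allowed). -/
def IsContractiveSimilitude (f : ℝ → ℝ) : Prop :=
  ∃ r a : ℝ, 0 < |r| ∧ |r| < 1 ∧ ∀ x, f x = r * x + a

/-- `K` is an attractor of the finite family of maps `F`: a non-empty compact set that is the
union of its images. For a family of contractive similitudes there is exactly one such set. -/
def IsAttractor {l : ℕ} (F : Fin l → ℝ → ℝ) (K : Set ℝ) : Prop :=
  K.Nonempty ∧ IsCompact K ∧ K = ⋃ i, F i '' K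

/-- A self-similar set in `ℝ`: the attractor of some finite family of contractive similitudes. -/
def IsSelfSimilarSet (K : Set ℝ) : Prop :=
  ∃ (l : ℕ) (F : Fin l → ℝ → ℝ), (∀ i, IsContractiveSimilitude (F i)) ∧ IsAttractor F K

/-- The homogeneous symmetric family `φ_i(x) = β x + i (1 - β) / N`, `i = 0, 1, …, N`. -/
noncomputable def phi (N : ℕ) (β : ℝ) (i : Fin (N + 1)) (x : ℝ) : ℝ :=
  β * x + (i : ℕ) * ((1 - β) / N)

/-- The set `𝓑_N` of all `0 < β < 1 / (N + 1)` such that an equality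
`∑_{k=1}^n i_k β^k = ∑_{k=1}^n j_k β^k` with `i_k ∈ {0, …, 2N}` and `j_k ∈ {0, …, N}`
forces `i_k = j_k` for all `k`. -/
def uniqueDigitSet (N : ℕ) : Set ℝ :=
  {β : ℝ | 0 < β ∧ β < 1 / ((N : ℝ) + 1) ∧
    ∀ (n : ℕ) (i j : ℕ → ℕ),
      (∀ k ∈ Finset.Icc 1 n, i k ≤ 2 * N) → (∀ k ∈ Finset.Icc 1 n, j k ≤ N) →
      ∑ k ∈ Finset.Icc 1 n, (i k : ℝ) * β ^ k = ∑ k ∈ Finset.Icc 1 n, (j k : ℝ) * β ^ k →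
      ∀ k ∈ Finset.Icc 1 n, i k = j k}

/-! Write `c = (1 - β) / N` and `K = Γ ∪ (Γ + t)`. Necessity: `K` has a centre of symmetry, so its
maps may be taken with positive ratio. The one whose image contains the left end `0` is a homothety,
and an iterate puts `K` inside `Γ`. Affine copies of `Γ` in `Γ` are cylinders (`exists_cylinder`),
so `t` has a terminating expansion with digits `d`. This makes `t` so large that every map sends `K`
into `Γ` or into `Γ + t`. A copy of `K` in `Γ` is a pair of cylinders `w`, `w'` of equal length
differing by a multiple of `t`, and membership in `uniqueDigitSet` makes `w'` the carry-free sum of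
`w` and `d`. As the copies cover `Γ`, every digit string has room to add or to subtract `d`
somewhere (`exists_room`). Test strings then leave `d` one nonzero digit, at most `(N + 1) / 2`.
Sufficiency: `t` shifts the leading digit of a cylinder by `i`, so cylinders pair up into copies of
`K` covering `Γ`. -/

/-! ### Values of finite digit strings. -/

open Finset in
/-- The value `∑_{k<n} d_k c β^k` of a finite string of digits. -/
noncomputable def digitSum (β c : ℝ) (d : ℕ → ℕ) (n : ℕ) : ℝ :=
  ∑ k ∈ range n, (d k : ℝ) * c * β ^ k

theorem digitSum_zero (β c : ℝ) (d : ℕ → ℕ) : digitSum β c d 0 = 0 := by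
  simp [digitSum]

theorem digitSum_succ_left (β c : ℝ) (d : ℕ → ℕ) (n : ℕ) :
    digitSum β c d (n + 1) = β * digitSum β c (fun k => d (k + 1)) n + d 0 * c := by
  unfold digitSum
  rw [Finset.sum_range_succ', Finset.mul_sum]
  simp only [pow_zero, mul_one, add_left_inj]
  exact Finset.sum_congr rfl fun k _ => by ring

theorem digitSum_cons (β c : ℝ) (i : ℕ) (d : ℕ → ℕ) (n : ℕ) :
    digitSum β c (fun k => Nat.casesOn k i d) (n + 1) = β * digitSum β c d n + i * c :=
  digitSum_succ_left _ _ _ _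

theorem digitSum_add (β c : ℝ) (d : ℕ → ℕ) (m n : ℕ) :
    digitSum β c d (m + n) =
      digitSum β c d m + β ^ m * digitSum β c (fun k => d (m + k)) n := by
  unfold digitSum
  rw [Finset.sum_range_add, Finset.mul_sum]
  congr 1
  exact Finset.sum_congr rfl fun k _ => by ring

/-- Prepending `m` zeros to a string of digits multiplies its value by `β ^ m`. -/
theorem digitSum_shift (β c : ℝ) (d : ℕ → ℕ) (m n : ℕ) :
    digitSum β c (fun k => if k < m then 0 else d (k - m)) (m + n) =
      β ^ m * digitSum β c d n := by
  rw [digitSum_add]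
  have h1 : digitSum β c (fun k => if k < m then 0 else d (k - m)) m = 0 := by
    unfold digitSum
    refine Finset.sum_eq_zero fun k hk => ?_
    simp [Finset.mem_range.1 hk]
  rw [h1, zero_add]
  congr 2
  funext k
  simp

theorem digitSum_single (β c : ℝ) (d : ℕ → ℕ) {n r : ℕ} (hr : r < n)
    (h : ∀ k < n, k ≠ r → d k = 0) : digitSum β c d n = d r * c * β ^ r := by
  unfold digitSum
  refine Finset.sum_eq_single r (fun k hk hkr => ?_) fun h' => ?_
  · simp [h k (Finset.mem_range.1 hk) hkr]
  · exact absurd (Finset.mem_range.2 hr) h'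

theorem finite_digitSum (β c : ℝ) (N n : ℕ) :
    {a : ℝ | ∃ d : ℕ → ℕ, (∀ k, d k ≤ N) ∧ a = digitSum β c d n}.Finite := by
  refine (Set.finite_range
    (fun w : Fin n → Fin (N + 1) => ∑ k : Fin n, ((w k : ℕ) : ℝ) * c * β ^ (k : ℕ))).subset ?_
  rintro a ⟨d, hd, rfl⟩
  refine ⟨fun k => ⟨d k, Nat.lt_succ_of_le (hd k)⟩, ?_⟩
  simp only [digitSum]
  rw [Finset.sum_range]

/-- Uniqueness of finite expansions for `β` in `uniqueDigitSet N`. -/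
theorem digit_eq_of_digitSum_eq {N : ℕ} {β c : ℝ} (hβ : β ∈ uniqueDigitSet N) (hc : c ≠ 0)
    {d e : ℕ → ℕ} {n : ℕ} (hd : ∀ k < n, d k ≤ 2 * N) (he : ∀ k < n, e k ≤ N)
    (h : digitSum β c d n = digitSum β c e n) {k : ℕ} (hk : k < n) : d k = e k := by
  have key : ∀ f : ℕ → ℕ, ∑ k ∈ Finset.Icc 1 n, (f (k - 1) : ℝ) * β ^ k =
      β / c * digitSum β c f n := by
    intro f
    rw [digitSum, Finset.mul_sum, Finset.range_eq_Ico,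
      ← Finset.Ico_add_one_right_eq_Icc, ← Finset.sum_Ico_add' _ 0 n 1]
    refine Finset.sum_congr rfl fun k _ => ?_
    field_simp
    simp only [Nat.add_sub_cancel]
    ring
  have := hβ.2.2 n (fun k => d (k - 1)) (fun k => e (k - 1))
    (fun k hk => hd _ (by rw [Finset.mem_Icc] at hk; omega))
    (fun k hk => he _ (by rw [Finset.mem_Icc] at hk; omega))
    (by rw [key, key, h]) (k + 1) (by rw [Finset.mem_Icc]; omega)
  simpa using this

/-- A compact set covered by its images under contractions lies in every non-empty closed set
that is invariant under the same contractions. -/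
theorem subset_of_contraction {ι : Type*} {f : ι → ℝ → ℝ} {β : ℝ} (hβ : β < 1)
    (hf : ∀ i x y, |f i x - f i y| ≤ β * |x - y|) {A B : Set ℝ}
    (hA : IsCompact A) (hAf : ∀ x ∈ A, ∃ i, ∃ y ∈ A, x = f i y)
    (hB : IsClosed B) (hBne : B.Nonempty) (hBf : ∀ i, ∀ y ∈ B, f i y ∈ B) : A ⊆ B := by
  rcases A.eq_empty_or_nonempty with rfl | hAne
  · exact Set.empty_subset _
  -- A point of `A` farthest from `B` is the image of another point of `A`, so the maximal distance
  -- is at most `max β 0 < 1` times itself.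
  obtain ⟨x, hx, hmax⟩ := hA.exists_isMaxOn hAne
    (Metric.continuous_infDist_pt B).continuousOn
  obtain ⟨i, y, hy, hxy⟩ := hAf x hx
  have h0 : Metric.infDist x B ≤ 0 := by
    have hle : Metric.infDist x B ≤ max β 0 * Metric.infDist y B := by
      refine le_of_forall_pos_le_add fun ε hε => ?_
      obtain ⟨z, hz, hzd⟩ := (Metric.infDist_lt_iff hBne (x := y)
        (r := Metric.infDist y B + ε)).1 (by linarith)
      have h1 : Metric.infDist x B ≤ dist x (f i z) := Metric.infDist_le_dist_of_mem (hBf i z hz)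
      have h2 : dist x (f i z) ≤ β * dist y z := by
        rw [hxy, Real.dist_eq, Real.dist_eq]; exact hf i y z
      have h3 : β * dist y z ≤ max β 0 * dist y z :=
        mul_le_mul_of_nonneg_right (le_max_left _ _) dist_nonneg
      have h4 : max β 0 * dist y z ≤ max β 0 * (Metric.infDist y B + ε) :=
        mul_le_mul_of_nonneg_left hzd.le (le_max_right _ _)
      have h5 : max β 0 * ε ≤ 1 * ε :=
        mul_le_mul_of_nonneg_right (max_le hβ.le zero_le_one) hε.le
      linarith
    have h1 : Metric.infDist y B ≤ Metric.infDist x B := hmax hy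
    have h2 : max β 0 < 1 := max_lt hβ one_pos
    have h3 := mul_le_mul_of_nonneg_left h1 (le_max_right β 0)
    nlinarith [Metric.infDist_nonneg (x := x) (s := B)]
  intro z hz
  have hz0 : Metric.infDist z B = 0 :=
    le_antisymm ((hmax hz).trans h0) Metric.infDist_nonneg
  exact (hB.mem_iff_infDist_zero hBne).2 hz0

/-! ### The Cantor set, its cylinders and its gaps. -/

/-- `Γ` is the attractor of `x ↦ β x + i c`, `0 ≤ i ≤ N`, normalised to have convex hull `[0, 1]`
and with pairwise disjoint pieces. -/
structure IsDigitCantorSet (N : ℕ) (β c : ℝ) (Γ : Set ℝ) : Prop where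
  pos : 0 < β
  lt_one : β < 1
  lt_step : β < c
  hull : (N : ℝ) * c + β = 1
  nonempty : Γ.Nonempty
  compact : IsCompact Γ
  mem_iff : ∀ x, x ∈ Γ ↔ ∃ i : ℕ, i ≤ N ∧ ∃ y ∈ Γ, x = β * y + i * c

theorem IsAttractor.isDigitCantorSet {N : ℕ} (hN : 1 ≤ N) {β : ℝ} (h0 : 0 < β)
    (h1 : β < 1 / ((N : ℝ) + 1)) {Γ : Set ℝ} (hΓ : IsAttractor (phi N β) Γ) :
    IsDigitCantorSet N β ((1 - β) / N) Γ := by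
  have hN' : (1 : ℝ) ≤ N := by exact_mod_cast hN
  have h2 : β * (N + 1) < 1 := by rwa [lt_div_iff₀ (by linarith)] at h1
  refine ⟨h0, by nlinarith, ?_, by field_simp; ring, hΓ.1, hΓ.2.1, fun x => ?_⟩
  · rw [lt_div_iff₀ (by linarith)]; linarith
  · conv_lhs => rw [hΓ.2.2]
    simp only [Set.mem_iUnion, Set.mem_image, phi]
    constructor
    · rintro ⟨i, y, hy, rfl⟩
      exact ⟨i, Nat.le_of_lt_succ i.2, y, hy, rfl⟩
    · rintro ⟨i, hi, y, hy, rfl⟩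
      exact ⟨⟨i, Nat.lt_succ_of_le hi⟩, y, hy, rfl⟩

namespace IsDigitCantorSet

variable {N : ℕ} {β c : ℝ} {Γ : Set ℝ}

theorem step_pos (h : IsDigitCantorSet N β c Γ) : 0 < c := h.pos.trans h.lt_step

theorem subset_of_invariant (h : IsDigitCantorSet N β c Γ) {A B : Set ℝ}
    (hA : IsCompact A) (hAf : ∀ x ∈ A, ∃ i : ℕ, i ≤ N ∧ ∃ y ∈ A, x = β * y + i * c)
    (hB : IsClosed B) (hBne : B.Nonempty)
    (hBf : ∀ i : ℕ, i ≤ N → ∀ y ∈ B, β * y + i * c ∈ B) : A ⊆ B := by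
  refine subset_of_contraction (ι := {i : ℕ // i ≤ N}) (f := fun i y => β * y + (i : ℕ) * c)
    h.lt_one (fun i x y => ?_) hA (fun x hx => ?_) hB hBne fun i y hy => hBf i i.2 y hy
  · rw [add_sub_add_right_eq_sub, ← mul_sub, abs_mul, abs_of_pos h.pos]
  · obtain ⟨i, hi, y, hy, hxy⟩ := hAf x hx
    exact ⟨⟨i, hi⟩, y, hy, hxy⟩

theorem subset_Icc (h : IsDigitCantorSet N β c Γ) : Γ ⊆ Set.Icc 0 1 := by
  refine h.subset_of_invariant h.compact (fun x => (h.mem_iff x).1) isClosed_Icc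
    ⟨0, by simp⟩ fun i hi y hy => ?_
  have hi' : (i : ℝ) ≤ N := by exact_mod_cast hi
  have h1 := mul_le_mul_of_nonneg_right hi' h.step_pos.le
  have h2 := mul_nonneg (Nat.cast_nonneg (α := ℝ) i) h.step_pos.le
  have h3 := mul_nonneg h.pos.le hy.1
  have h4 := mul_le_mul_of_nonneg_left hy.2 h.pos.le
  exact ⟨by linarith, by linarith [h.hull]⟩

theorem zero_mem (h : IsDigitCantorSet N β c Γ) : (0 : ℝ) ∈ Γ := by
  refine h.subset_of_invariant (A := {0}) isCompact_singleton (fun x hx => ?_)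
    h.compact.isClosed h.nonempty (fun i hi y hy => (h.mem_iff _).2 ⟨i, hi, y, hy, rfl⟩) rfl
  exact ⟨0, Nat.zero_le _, 0, rfl, by simpa using hx⟩

/-- Reflection replaces each digit `i` by `N - i`, because `N c + β = 1`. -/
theorem one_sub_mem (h : IsDigitCantorSet N β c Γ) {x : ℝ} (hx : x ∈ Γ) : 1 - x ∈ Γ := by
  have : (fun x => 1 - x) '' Γ ⊆ Γ := by
    refine h.subset_of_invariant (h.compact.image (by fun_prop)) ?_
      h.compact.isClosed h.nonempty fun i hi y hy => (h.mem_iff _).2 ⟨i, hi, y, hy, rfl⟩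
    rintro _ ⟨x, hx, rfl⟩
    obtain ⟨i, hi, y, hy, rfl⟩ := (h.mem_iff x).1 hx
    refine ⟨N - i, Nat.sub_le _ _, 1 - y, ⟨y, hy, rfl⟩, ?_⟩
    push_cast [hi]
    linarith [h.hull]
  exact this ⟨x, hx, rfl⟩

theorem one_mem (h : IsDigitCantorSet N β c Γ) : (1 : ℝ) ∈ Γ := by
  simpa using h.one_sub_mem h.zero_mem

theorem digitSum_add_mem (h : IsDigitCantorSet N β c Γ) {d : ℕ → ℕ} {n : ℕ}
    (hd : ∀ k < n, d k ≤ N) {y : ℝ} (hy : y ∈ Γ) : digitSum β c d n + β ^ n * y ∈ Γ := by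
  induction n generalizing d with
  | zero => simpa [digitSum_zero] using hy
  | succ n ih =>
    rw [h.mem_iff]
    refine ⟨d 0, hd 0 (Nat.succ_pos n), _, ih (d := fun k => d (k + 1))
      (fun k hk => hd _ (Nat.succ_lt_succ hk)), ?_⟩
    rw [digitSum_succ_left]
    ring

theorem digitSum_mem (h : IsDigitCantorSet N β c Γ) {d : ℕ → ℕ} {n : ℕ}
    (hd : ∀ k < n, d k ≤ N) : digitSum β c d n ∈ Γ := by
  simpa using h.digitSum_add_mem hd h.zero_mem

theorem exists_digitSum (h : IsDigitCantorSet N β c Γ) (n : ℕ) {x : ℝ} (hx : x ∈ Γ) :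
    ∃ d : ℕ → ℕ, (∀ k, d k ≤ N) ∧ ∃ y ∈ Γ, x = digitSum β c d n + β ^ n * y := by
  induction n generalizing x with
  | zero => exact ⟨0, by simp, x, hx, by simp [digitSum_zero]⟩
  | succ n ih =>
    obtain ⟨i, hi, y, hy, rfl⟩ := (h.mem_iff x).1 hx
    obtain ⟨d, hd, z, hz, rfl⟩ := ih hy
    refine ⟨fun k => Nat.casesOn k i d, fun k => ?_, z, hz, ?_⟩
    · cases k
      · exact hi
      · exact hd _
    · rw [digitSum_cons]
      ring

/-- The first-level pieces are separated. -/
theorem first_digit_eq (h : IsDigitCantorSet N β c Γ) {i j : ℕ} {y z : ℝ}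
    (hy : y ∈ Set.Icc (0 : ℝ) 1) (hz : z ∈ Set.Icc (0 : ℝ) 1)
    (hyz : β * y + i * c = β * z + j * c) : i = j := by
  have key : ∀ {i j : ℕ} {y z : ℝ}, y ∈ Set.Icc (0 : ℝ) 1 → z ∈ Set.Icc (0 : ℝ) 1 →
      β * y + i * c = β * z + j * c → ¬ i < j := by
    intro i j y z hy hz hyz hij
    have hij' : (i : ℝ) + 1 ≤ j := by exact_mod_cast hij
    have h1 := mul_le_mul_of_nonneg_right hij' h.step_pos.le
    have h2 := mul_nonneg h.pos.le hz.1
    have h3 := mul_le_mul_of_nonneg_left hy.2 h.pos.le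
    linarith [h.lt_step]
  exact le_antisymm (not_lt.1 (key hz hy hyz.symm)) (not_lt.1 (key hy hz hyz))

theorem digits_eq (h : IsDigitCantorSet N β c Γ) {d e : ℕ → ℕ} {n : ℕ}
    (hd : ∀ k < n, d k ≤ N) (he : ∀ k < n, e k ≤ N) {y z : ℝ} (hy : y ∈ Γ) (hz : z ∈ Γ)
    (hyz : digitSum β c d n + β ^ n * y = digitSum β c e n + β ^ n * z) {k : ℕ} (hk : k < n) :
    d k = e k := by
  induction n generalizing d e k with
  | zero => omega
  | succ n ih =>
    have hd' : ∀ k < n, d (k + 1) ≤ N := fun k hk => hd _ (Nat.succ_lt_succ hk)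
    have he' : ∀ k < n, e (k + 1) ≤ N := fun k hk => he _ (Nat.succ_lt_succ hk)
    rw [digitSum_succ_left, digitSum_succ_left] at hyz
    have h0 : d 0 = e 0 := h.first_digit_eq
      (h.subset_Icc (h.digitSum_add_mem hd' hy)) (h.subset_Icc (h.digitSum_add_mem he' hz))
      (by linear_combination hyz)
    cases k with
    | zero => exact h0
    | succ k =>
      refine ih hd' he' ?_ (Nat.lt_of_succ_lt_succ hk)
      rw [h0] at hyz
      refine mul_left_cancel₀ h.pos.ne' ?_
      linear_combination hyz

/-- Every interval longer than `c - β` inside `[0, 1]` meets `Γ`. -/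
theorem exists_mem_Ioo (h : IsDigitCantorSet N β c Γ) {u v : ℝ} (hu : 0 ≤ u) (hv : v ≤ 1)
    (huv : c - β < v - u) : ∃ x ∈ Γ, u < x ∧ x < v := by
  obtain ⟨n, hn⟩ := exists_pow_lt_of_lt_one
    (show (0 : ℝ) < v - u by linarith [h.lt_step]) h.lt_one
  -- Each rescaling by `β⁻¹` lengthens the interval; at `n = 0` it would be longer than `1`.
  induction n generalizing u v with
  | zero => rw [pow_zero] at hn; linarith
  | succ n ih =>
    have hc := h.step_pos
    have hi1 : (⌊u / c⌋₊ : ℝ) * c ≤ u := by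
      rw [← le_div_iff₀ hc]; exact Nat.floor_le (by positivity)
    have hi2 : u < ((⌊u / c⌋₊ : ℝ) + 1) * c := by
      rw [← div_lt_iff₀ hc]; exact Nat.lt_floor_add_one _
    generalize ⌊u / c⌋₊ = i at hi1 hi2
    have hiN : i ≤ N := by
      by_contra! hlt
      have h1 : (N : ℝ) + 1 ≤ i := by exact_mod_cast hlt
      have h2 := mul_le_mul_of_nonneg_right h1 hc.le
      linarith [h.hull, h.lt_step]
    rcases lt_or_ge (((i : ℝ) + 1) * c) v with h1 | h1
    · rcases hiN.lt_or_eq with h2 | rfl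
      · exact ⟨(i + 1) * c, (h.mem_iff _).2 ⟨i + 1, h2, 0, h.zero_mem, by simp⟩, hi2, h1⟩
      · linarith [h.hull, h.lt_step]
    rcases lt_or_ge (β + i * c) v with h2 | h2
    · exact ⟨β + i * c, (h.mem_iff _).2 ⟨i, hiN, 1, h.one_mem, by simp⟩, by linarith, h2⟩
    -- Neither end point of a piece was available, so the interval lies in the hull of piece `i`;
    -- zoom in.
    have hb := h.pos
    obtain ⟨x, hx, hx1, hx2⟩ := ih (u := (u - i * c) / β) (v := (v - i * c) / β)
      (div_nonneg (by linarith) hb.le) (by rw [div_le_one hb]; linarith)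
      (by
        rw [← sub_div, lt_div_iff₀ hb]
        nlinarith [h.lt_step, h.lt_one])
      (by
        rw [← sub_div, lt_div_iff₀ hb, ← pow_succ]
        linarith)
    rw [div_lt_iff₀ hb] at hx1
    rw [lt_div_iff₀ hb] at hx2
    exact ⟨β * x + i * c, (h.mem_iff _).2 ⟨i, hiN, x, hx, rfl⟩, by linarith, by linarith⟩

/-- An affine copy of `Γ` with ratio `μ` meets any interval longer than `μ (c - β)` that lies
in its convex hull. -/
theorem exists_affine_mem_Ioo (h : IsDigitCantorSet N β c Γ) {μ τ p q : ℝ} (hμ : 0 < μ)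
    (hp : τ ≤ p) (hq : q ≤ τ + μ) (hpq : μ * (c - β) < q - p) :
    ∃ x ∈ Γ, p < μ * x + τ ∧ μ * x + τ < q := by
  obtain ⟨x, hx, h1, h2⟩ := h.exists_mem_Ioo (u := (p - τ) / μ) (v := (q - τ) / μ)
    (div_nonneg (by linarith) hμ.le) (by rw [div_le_one hμ]; linarith)
    (by rw [← sub_div, lt_div_iff₀ hμ]; linarith)
  rw [div_lt_iff₀ hμ] at h1
  rw [lt_div_iff₀ hμ] at h2
  exact ⟨x, hx, by linarith, by linarith⟩

/-- An orientation preserving affine copy of `Γ` inside `Γ` is a cylinder. -/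
theorem exists_cylinder (h : IsDigitCantorSet N β c Γ) {μ τ : ℝ} (hμ : 0 < μ)
    (hsub : ∀ x ∈ Γ, μ * x + τ ∈ Γ) :
    ∃ (n : ℕ) (d : ℕ → ℕ), (∀ k, d k ≤ N) ∧ μ = β ^ n ∧ τ = digitSum β c d n := by
  obtain ⟨M, hM⟩ : ∃ M, β ^ M ≤ μ :=
    (exists_pow_lt_of_lt_one hμ h.lt_one).imp fun _ => le_of_lt
  -- `M` bounds the number of digits that can be stripped; once `μ ≥ 1` the copy is all of `Γ`.
  induction M generalizing μ τ with
  | zero =>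
    have h0 := h.subset_Icc (hsub 0 h.zero_mem)
    have h1 := h.subset_Icc (hsub 1 h.one_mem)
    simp only [Set.mem_Icc, pow_zero] at h0 h1 hM
    exact ⟨0, 0, by simp, by rw [pow_zero]; linarith, by rw [digitSum_zero]; linarith⟩
  | succ M ih =>
    obtain ⟨i, hi, y, hy, hy'⟩ := (h.mem_iff _).1 (hsub 0 h.zero_mem)
    obtain ⟨j, hj, z, hz, hz'⟩ := (h.mem_iff _).1 (hsub 1 h.one_mem)
    have hb := h.pos
    have hyI := h.subset_Icc hy
    have hzI := h.subset_Icc hz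
    have hy0 := mul_nonneg hb.le hyI.1
    have hy1 := mul_le_mul_of_nonneg_left hyI.2 hb.le
    have hz0 := mul_nonneg hb.le hzI.1
    have hz1 := mul_le_mul_of_nonneg_left hzI.2 hb.le
    have hc := h.step_pos
    -- a point of `Γ` in the convex hull of a first-level piece belongs to that piece
    have hpiece : ∀ i : ℕ, ∀ x ∈ Γ, i * c ≤ x → x < (i + 1 : ℝ) * c →
        ∃ y ∈ Γ, x = β * y + i * c := by
      intro i x hx h1 h2
      obtain ⟨k, hk, w, hw, rfl⟩ := (h.mem_iff _).1 hx
      have hwI := h.subset_Icc hw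
      have hw0 := mul_nonneg hb.le hwI.1
      have hw1 := mul_le_mul_of_nonneg_left hwI.2 hb.le
      have e1 : k < i + 1 := by
        by_contra! hlt
        have h3 : (i : ℝ) + 1 ≤ k := by exact_mod_cast hlt
        have h4 := mul_le_mul_of_nonneg_right h3 hc.le
        linarith
      have e2 : i < k + 1 := by
        by_contra! hlt
        have h3 : (k : ℝ) + 1 ≤ i := by exact_mod_cast hlt
        have h4 := mul_le_mul_of_nonneg_right h3 hc.le
        linarith [h.lt_step]
      obtain rfl : k = i := by omega
      exact ⟨w, hw, rfl⟩
    rcases lt_trichotomy i j with hij | rfl | hij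
    · have hij' : (i : ℝ) + 1 ≤ j := by exact_mod_cast hij
      have h1 := mul_le_mul_of_nonneg_right hij' hc.le
      rcases lt_or_ge μ 1 with hμ1 | hμ1
      -- The copy would bridge the gap after piece `i`, of length `c - β`, while its own gaps are at
      -- most `μ (c - β)`.
      · exfalso
        obtain ⟨x, hx, hx1, hx2⟩ := h.exists_affine_mem_Ioo (τ := τ) (p := β + i * c)
          (q := (i + 1) * c) hμ (by linarith) (by linarith) (by nlinarith [h.lt_step])
        obtain ⟨w, hw, hw'⟩ := hpiece i _ (hsub x hx) (by linarith) hx2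
        have hw1 := mul_le_mul_of_nonneg_left (h.subset_Icc hw).2 hb.le
        linarith
      · have h0 := h.subset_Icc (hsub 0 h.zero_mem)
        have h1 := h.subset_Icc (hsub 1 h.one_mem)
        simp only [Set.mem_Icc] at h0 h1
        exact ⟨0, 0, by simp, by rw [pow_zero]; linarith, by rw [digitSum_zero]; linarith⟩
    · obtain ⟨n, d, hd, h1, h2⟩ := ih (μ := μ / β) (τ := (τ - i * c) / β) (by positivity)
        (by
          intro x hx
          have hxI := h.subset_Icc hx
          have hx0 := mul_nonneg hμ.le hxI.1
          have hx1 := mul_le_mul_of_nonneg_left hxI.2 hμ.le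
          obtain ⟨w, hw, hw'⟩ := hpiece i _ (hsub x hx) (by linarith)
            (by linarith [h.lt_step])
          convert hw using 1
          field_simp
          linarith)
        (by rw [le_div_iff₀ hb, ← pow_succ]; exact hM)
      refine ⟨n + 1, fun k => Nat.casesOn k i d, fun k => ?_, ?_, ?_⟩
      · cases k
        · exact hi
        · exact hd _
      · rw [pow_succ, ← h1]; field_simp
      · rw [digitSum_cons, ← h2]; field_simp; ring
    · exfalso
      have hij' : (j : ℝ) + 1 ≤ i := by exact_mod_cast hij
      have h1 := mul_le_mul_of_nonneg_right hij' hc.le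
      linarith [h.lt_step]

end IsDigitCantorSet

/-! ### Carry-free addition and criteria for self-similarity. -/

theorem digitSum_add_digits (β c : ℝ) (d e : ℕ → ℕ) (n : ℕ) :
    digitSum β c (fun k => d k + e k) n = digitSum β c d n + digitSum β c e n := by
  unfold digitSum
  rw [← Finset.sum_add_distrib]
  exact Finset.sum_congr rfl fun k _ => by push_cast; ring

/-- If two strings `w`, `w'` differ in value by the string `d` written so that both end at the same
position, then `w'` is the digitwise sum: no carries occur. -/
theorem digit_add_of_digitSum_add {N : ℕ} {β c t : ℝ} (hβ : β ∈ uniqueDigitSet N) (hc : c ≠ 0)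
    {d w w' : ℕ → ℕ} {n q : ℕ} (hd : ∀ k, d k ≤ N) (hw : ∀ k, w k ≤ N) (hw' : ∀ k, w' k ≤ N)
    (ht : β ^ q * t = digitSum β c d q)
    (h : digitSum β c w' n = digitSum β c w n + β ^ n * t) {r : ℕ} (hr : r < q) (hdr : d r ≠ 0) :
    q ≤ n + r ∧ w' (n + r - q) = w (n + r - q) + d r := by
  -- After scaling by `β ^ q`, the words `w`, `w'` start at position `q` and `d` at position `n`.
  -- Digits on the left are at most `2 N`, on the right at most `N`.
  have key := digit_eq_of_digitSum_eq (n := n + q) hβ hc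
    (d := fun k => (if k < q then 0 else w (k - q)) + (if k < n then 0 else d (k - n)))
    (e := fun k => if k < q then 0 else w' (k - q))
    (fun k _ => by
      have := hw (k - q)
      have := hd (k - n)
      split_ifs <;> omega)
    (fun k _ => by
      have := hw' (k - q)
      split_ifs <;> omega)
    (by
      rw [digitSum_add_digits, digitSum_shift, add_comm n q, digitSum_shift, digitSum_shift,
        h, ← ht]
      ring)
    (show n + r < n + q by omega)
  have e1 : n + r - n = r := by omega
  simp only [e1, not_lt.2 (Nat.le_add_right n r), if_false] at key
  split_ifs at key with hlt <;> omega

/-- A self-similar set with a centre of symmetry is the attractor of orientation preserving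
similitudes. -/
theorem IsSelfSimilarSet.exists_pos_ratio {K : Set ℝ} (hK : IsSelfSimilarSet K) {s : ℝ}
    (hs : ∀ x ∈ K, s - x ∈ K) :
    ∃ (l : ℕ) (μ a : Fin l → ℝ), (∀ i, 0 < μ i ∧ μ i < 1) ∧
      (∀ i, ∀ x ∈ K, μ i * x + a i ∈ K) ∧ ∀ x ∈ K, ∃ i, ∃ y ∈ K, x = μ i * y + a i := by
  obtain ⟨l, F, hF, -, -, hKF⟩ := hK
  have hsub : ∀ i, ∀ x ∈ K, F i x ∈ K := fun i x hx => by
    rw [hKF]; exact Set.mem_iUnion.2 ⟨i, x, hx, rfl⟩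
  have key : ∀ i, ∃ μ a : ℝ, (0 < μ ∧ μ < 1) ∧ (∀ x ∈ K, μ * x + a ∈ K) ∧
      ∀ x ∈ K, ∃ y ∈ K, F i x = μ * y + a := by
    intro i
    obtain ⟨r, a, h0, h1, hr⟩ := hF i
    rcases lt_or_ge 0 r with hpos | hneg
    · rw [abs_of_pos hpos] at h1
      exact ⟨r, a, ⟨hpos, h1⟩, fun x hx => hr x ▸ hsub i x hx, fun x hx => ⟨x, hx, hr x⟩⟩
    · rw [abs_of_nonpos hneg] at h0 h1
      -- Precompose with the symmetry `x ↦ s - x`.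
      refine ⟨-r, r * s + a, ⟨h0, h1⟩, fun x hx => ?_, fun x hx => ⟨s - x, hs x hx, ?_⟩⟩
      · have := hsub i _ (hs x hx)
        rw [hr] at this
        convert this using 1
        ring
      · rw [hr]; ring
  choose μ a h1 h2 h3 using key
  refine ⟨l, μ, a, h1, h2, fun x hx => ?_⟩
  rw [hKF] at hx
  obtain ⟨i, y, hy, rfl⟩ := Set.mem_iUnion.1 hx
  exact ⟨i, h3 i y hy⟩

/-- A criterion for self-similarity with translations ranging over a finite set. -/
theorem isSelfSimilarSet_of_finite {K : Set ℝ} (hne : K.Nonempty) (hK : IsCompact K) {r : ℝ}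
    (h0 : 0 < r) (h1 : r < 1) {T : Set ℝ} (hT : T.Finite)
    (hsub : ∀ a ∈ T, ∀ x ∈ K, r * x + a ∈ K)
    (hcover : ∀ x ∈ K, ∃ a ∈ T, ∃ y ∈ K, x = r * y + a) : IsSelfSimilarSet K := by
  obtain ⟨l, e, he⟩ : ∃ (l : ℕ) (e : Fin l → ℝ), Set.range e = T :=
    have := hT.to_subtype
    ⟨Nat.card T, fun i => ((Finite.equivFin T).symm i : ℝ), by
      ext x
      constructor
      · rintro ⟨i, rfl⟩
        exact Subtype.property _
      · intro hx
        exact ⟨Finite.equivFin T ⟨x, hx⟩,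
          congrArg Subtype.val ((Finite.equivFin T).symm_apply_apply ⟨x, hx⟩)⟩⟩
  refine ⟨l, fun i x => r * x + e i, fun i => ⟨r, e i, ?_, ?_, fun _ => rfl⟩, hne, hK, ?_⟩
  · rwa [abs_of_pos h0]
  · rwa [abs_of_pos h0]
  · ext x
    simp only [Set.mem_iUnion, Set.mem_image]
    constructor
    · intro hx
      obtain ⟨a, ha, y, hy, rfl⟩ := hcover x hx
      obtain ⟨i, rfl⟩ := he.symm ▸ ha
      exact ⟨i, y, hy, rfl⟩
    · rintro ⟨i, y, hy, rfl⟩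
      exact hsub _ (he ▸ Set.mem_range_self i) y hy

theorem mem_union_translate {Γ : Set ℝ} {t x : ℝ} :
    x ∈ Γ ∪ (fun x => x + t) '' Γ ↔ x ∈ Γ ∨ x - t ∈ Γ := by
  rw [Set.mem_union, Set.mem_image]
  refine or_congr_right ⟨?_, fun hx => ⟨x - t, hx, by ring⟩⟩
  rintro ⟨y, hy, rfl⟩
  simpa using hy

/-! ### The union of `Γ` and its translate. -/

namespace IsDigitCantorSet

variable {N : ℕ} {β c t : ℝ} {Γ : Set ℝ}

theorem sub_mem_union_translate (h : IsDigitCantorSet N β c Γ) {x : ℝ}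
    (hx : x ∈ Γ ∪ (fun x => x + t) '' Γ) : 1 + t - x ∈ Γ ∪ (fun x => x + t) '' Γ := by
  rw [mem_union_translate] at hx ⊢
  rcases hx with hx | hx
  · right
    convert h.one_sub_mem hx using 1
    ring
  · left
    convert h.one_sub_mem hx using 1
    ring

/-- If a homothety centred at the left end point maps `Γ ∪ (Γ + t)` into itself, then `t` is a
terminating expansion in base `β⁻¹`. -/
theorem exists_expansion (h : IsDigitCantorSet N β c Γ) (ht : 0 < t) {μ : ℝ} (hμ : 0 < μ)
    (hμ1 : μ < 1) (hsub : ∀ x ∈ Γ ∪ (fun x => x + t) '' Γ, μ * x ∈ Γ ∪ (fun x => x + t) '' Γ) :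
    ∃ (q : ℕ) (d : ℕ → ℕ), (∀ k, d k ≤ N) ∧ β ^ q * t = digitSum β c d q := by
  have hpow : ∀ n : ℕ, ∀ x ∈ Γ ∪ (fun x => x + t) '' Γ,
      μ ^ n * x ∈ Γ ∪ (fun x => x + t) '' Γ := by
    intro n
    induction n with
    | zero => simp
    | succ n ih =>
      intro x hx
      rw [pow_succ, mul_assoc]
      exact ih _ (hsub x hx)
  -- Chosen so that `μ ^ n (1 + t) < t`: the shrunken union stays to the left of `Γ + t`.
  obtain ⟨n, hn⟩ := exists_pow_lt_of_lt_one (show 0 < t / (1 + t) by positivity) hμ1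
  rw [lt_div_iff₀ (by positivity)] at hn
  have hν : 0 < μ ^ n := pow_pos hμ n
  have hΓ : ∀ x ∈ Γ ∪ (fun x => x + t) '' Γ, μ ^ n * x ∈ Γ := by
    intro x hx
    refine (mem_union_translate.1 (hpow n x hx)).resolve_right fun hmem => ?_
    have h0 := (h.subset_Icc hmem).1
    have hx1 : x ≤ 1 + t := by
      rcases mem_union_translate.1 hx with hx | hx
      · linarith [(h.subset_Icc hx).2]
      · linarith [(h.subset_Icc hx).2]
    have := mul_le_mul_of_nonneg_left hx1 hν.le
    linarith
  obtain ⟨q, d, hd, h1, h2⟩ := h.exists_cylinder (μ := μ ^ n) (τ := μ ^ n * t) hν fun x hx => by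
    rw [← mul_add]
    exact hΓ _ (Or.inr ⟨x, hx, rfl⟩)
  exact ⟨q, d, hd, by rw [← h1, h2]⟩

theorem exists_digit_ne_zero (h : IsDigitCantorSet N β c Γ) (ht : 0 < t) {q : ℕ} {d : ℕ → ℕ}
    (hq : β ^ q * t = digitSum β c d q) : ∃ r < q, d r ≠ 0 := by
  by_contra! hall
  have h0 : digitSum β c d q = 0 :=
    Finset.sum_eq_zero fun k hk => by simp [hall k (Finset.mem_range.1 hk)]
  rw [h0] at hq
  exact (mul_pos (pow_pos h.pos q) ht).ne' hq

/-- A nonzero digit at a position `r < q` gives `t ≥ c / β`, hence `t - 1 ≥ (c - β) / β`. So the gap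
between `Γ` and `Γ + t` exceeds every gap of `Γ`. -/
theorem gap_lt (h : IsDigitCantorSet N β c Γ) (ht : 0 < t) {q : ℕ} {d : ℕ → ℕ}
    (hq : β ^ q * t = digitSum β c d q) : c - β < t - 1 := by
  obtain ⟨r, hr, hdr⟩ := h.exists_digit_ne_zero ht hq
  have hb := h.pos
  have hc := h.step_pos
  have h1 : (d r : ℝ) * c * β ^ r ≤ digitSum β c d q :=
    Finset.single_le_sum (f := fun k => (d k : ℝ) * c * β ^ k) (fun k _ => by positivity)
      (Finset.mem_range.2 hr)
  have h2 : (1 : ℝ) ≤ d r := by exact_mod_cast Nat.one_le_iff_ne_zero.2 hdr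
  have h3 : c * β ^ r ≤ d r * c * β ^ r := by
    rw [mul_assoc]
    exact le_mul_of_one_le_left (by positivity) h2
  have h4 : β ^ q ≤ β ^ (r + 1) := pow_le_pow_of_le_one hb.le h.lt_one.le hr
  have h5 : c * β ^ r ≤ β ^ r * (β * t) := by
    have := mul_le_mul_of_nonneg_right h4 ht.le
    rw [pow_succ] at this
    linarith
  have h6 : c ≤ β * t := by
    have hp : 0 < β ^ r := pow_pos hb r
    rw [mul_comm c] at h5
    exact le_of_mul_le_mul_left h5 hp
  have h7 := h.lt_one
  have h8 := h.lt_step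
  nlinarith

/-- When the translate is far away, a small copy of `Γ` lies in one of the two translates. -/
theorem copy_subset_or (h : IsDigitCantorSet N β c Γ) (ht : c - β < t - 1) {μ a : ℝ}
    (hμ : 0 < μ) (hμ1 : μ < 1) (hsub : ∀ x ∈ Γ, μ * x + a ∈ Γ ∪ (fun x => x + t) '' Γ) :
    (∀ x ∈ Γ, μ * x + a ∈ Γ) ∨ ∀ x ∈ Γ, μ * x + (a - t) ∈ Γ := by
  simp only [mem_union_translate] at hsub
  rcases lt_or_ge 1 a with h1 | h1
  · right
    intro x hx
    rw [← add_sub_assoc]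
    refine (hsub x hx).resolve_left fun hmem => ?_
    have h2 := (h.subset_Icc hmem).2
    have h3 := mul_nonneg hμ.le (h.subset_Icc hx).1
    linarith
  rcases lt_or_ge (a + μ) t with h2 | h2
  · left
    intro x hx
    refine (hsub x hx).resolve_right fun hmem => ?_
    have h3 := (h.subset_Icc hmem).1
    have h4 := mul_le_mul_of_nonneg_left (h.subset_Icc hx).2 hμ.le
    linarith
  · exfalso
    obtain ⟨x, hx, hx1, hx2⟩ := h.exists_affine_mem_Ioo hμ h1 h2 (by nlinarith [h.lt_step])
    rcases hsub x hx with hmem | hmem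
    · linarith [(h.subset_Icc hmem).2]
    · linarith [(h.subset_Icc hmem).1]

/-- When the translate is far away, a small copy of `Γ ∪ (Γ + t)` lies in one of the two
translates. -/
theorem union_copy_subset_or (h : IsDigitCantorSet N β c Γ) (ht : c - β < t - 1) {μ a : ℝ}
    (hμ : 0 < μ) (hμ1 : μ < 1)
    (hsub : ∀ x ∈ Γ ∪ (fun x => x + t) '' Γ, μ * x + a ∈ Γ ∪ (fun x => x + t) '' Γ) :
    ((∀ x ∈ Γ, μ * x + a ∈ Γ) ∧ ∀ x ∈ Γ, μ * x + (a + μ * t) ∈ Γ) ∨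
      ((∀ x ∈ Γ, μ * x + (a - t) ∈ Γ) ∧ ∀ x ∈ Γ, μ * x + (a + μ * t - t) ∈ Γ) := by
  have ht1 : 1 < t := by linarith [h.lt_step]
  have hA := h.copy_subset_or ht hμ hμ1 fun x hx => hsub x (Or.inl hx)
  have hB := h.copy_subset_or ht hμ hμ1 (a := a + μ * t) fun x hx => by
    convert hsub (x + t) (Or.inr ⟨x, hx, rfl⟩) using 1
    ring
  rcases hA with hA | hA <;> rcases hB with hB | hB
  · exact Or.inl ⟨hA, hB⟩
  -- This would give `t (1 - μ) ≤ a ≤ 1 - μ`, against `1 < t`.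
  · exfalso
    have h1 := (h.subset_Icc (hA 1 h.one_mem)).2
    have h2 := (h.subset_Icc (hB 0 h.zero_mem)).1
    nlinarith
  · exfalso
    have h1 := (h.subset_Icc (hA 0 h.zero_mem)).1
    have h2 := (h.subset_Icc (hB 0 h.zero_mem)).2
    nlinarith
  · exact Or.inr ⟨hA, hB⟩

/-- If `Γ ∪ (Γ + t)` is self-similar then every string of digits has, for some `n`, either room for
adding the digits `d` of `t` ending at position `n`, or room for subtracting them. -/
theorem exists_room (h : IsDigitCantorSet N β c Γ) (hβ : β ∈ uniqueDigitSet N) (ht : 0 < t)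
    {q : ℕ} {d : ℕ → ℕ} (hd : ∀ k, d k ≤ N) (hq : β ^ q * t = digitSum β c d q)
    {l : ℕ} {μ a : Fin l → ℝ} (hμ : ∀ i, 0 < μ i ∧ μ i < 1)
    (hsub : ∀ i, ∀ x ∈ Γ ∪ (fun x => x + t) '' Γ, μ i * x + a i ∈ Γ ∪ (fun x => x + t) '' Γ)
    (hcover : ∀ x ∈ Γ ∪ (fun x => x + t) '' Γ, ∃ i, ∃ y ∈ Γ ∪ (fun x => x + t) '' Γ,
      x = μ i * y + a i) {x : ℕ → ℕ} (hx : ∀ k, x k ≤ N) :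
    ∃ n : ℕ, (∀ r < q, d r ≠ 0 → q ≤ n + r) ∧
      ((∀ r < q, d r ≠ 0 → x (n + r - q) + d r ≤ N) ∨
        ∀ r < q, d r ≠ 0 → d r ≤ x (n + r - q)) := by
  have hgap := h.gap_lt ht hq
  have ht1 : 1 < t := by linarith [h.lt_step]
  have hcyl := fun i => h.union_copy_subset_or hgap (hμ i).1 (hμ i).2 (hsub i)
  have hlen : ∀ i, ∃ n : ℕ, μ i = β ^ n := by
    intro i
    rcases hcyl i with hc | hc
    · obtain ⟨n, w, -, hn, -⟩ := h.exists_cylinder (hμ i).1 hc.1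
      exact ⟨n, hn⟩
    · obtain ⟨n, w, -, hn, -⟩ := h.exists_cylinder (hμ i).1 hc.1
      exact ⟨n, hn⟩
  choose len hlen using hlen
  -- Truncating `x` at the longest cylinder length makes the word of whichever copy covers the point
  -- a prefix of `x`.
  obtain ⟨M, hM⟩ := (Set.finite_range len).bddAbove
  have hpt : digitSum β c x M ∈ Γ := h.digitSum_mem fun k _ => hx k
  obtain ⟨i, y, hy, hxy⟩ := hcover _ (Or.inl hpt)
  have hiM : len i ≤ M := hM ⟨i, rfl⟩
  have hpI := h.subset_Icc hpt
  have hc : (∀ x ∈ Γ, μ i * x + a i ∈ Γ) ∧ ∀ x ∈ Γ, μ i * x + (a i + μ i * t) ∈ Γ := by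
    refine (hcyl i).resolve_right fun hc => ?_
    have : digitSum β c x M - t ∈ Γ := by
      rw [hxy]
      rcases mem_union_translate.1 hy with hy | hy
      · convert hc.1 y hy using 1
        ring
      · convert hc.2 _ hy using 1
        ring
    linarith [(h.subset_Icc this).1, hpI.2]
  obtain ⟨n, w, hw, hn, hwn⟩ := h.exists_cylinder (hμ i).1 hc.1
  obtain ⟨n', w', hw', hn', hwn'⟩ := h.exists_cylinder (hμ i).1 hc.2
  have hinj := pow_right_injective₀ h.pos h.lt_one.ne
  obtain rfl : n = n' := hinj (hn.symm.trans hn')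
  have hnM : n ≤ M := by
    rwa [hinj ((hlen i).symm.trans hn)] at hiM
  have hstep := fun r (hr : r < q) (hdr : d r ≠ 0) =>
    digit_add_of_digitSum_add hβ h.step_pos.ne' hd hw hw' hq
      (by rw [← hwn, ← hwn', hn]) hr hdr
  have hsplit : digitSum β c x M =
      digitSum β c x n + β ^ n * digitSum β c (fun k => x (n + k)) (M - n) := by
    rw [← digitSum_add, Nat.add_sub_cancel' hnM]
  have htail : digitSum β c (fun k => x (n + k)) (M - n) ∈ Γ := h.digitSum_mem fun k _ => hx _
  refine ⟨n, fun r hr hdr => (hstep r hr hdr).1, ?_⟩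
  -- The prefix of `x` is `w` in the first case and `w' = w + d` in the second, giving room to add
  -- or to subtract.
  rcases mem_union_translate.1 hy with hy | hy
  · left
    intro r hr hdr
    obtain ⟨h1, h2⟩ := hstep r hr hdr
    rw [h.digits_eq (n := n) (fun k _ => hx k) (fun k _ => hw k) htail hy
      (by rw [← hsplit, hxy, hn, hwn]; ring) (by omega), ← h2]
    exact hw' _
  · right
    intro r hr hdr
    obtain ⟨h1, h2⟩ := hstep r hr hdr
    rw [h.digits_eq (n := n) (fun k _ => hx k) (fun k _ => hw' k) htail hy
      (by rw [← hsplit, hxy, ← hwn', hn]; ring) (by omega), h2]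
    exact Nat.le_add_left _ _

/-! ### The two implications. -/

theorem eq_of_isSelfSimilarSet (h : IsDigitCantorSet N β c Γ) (hβ : β ∈ uniqueDigitSet N)
    (ht : 0 < t) (hK : IsSelfSimilarSet (Γ ∪ (fun x => x + t) '' Γ)) :
    ∃ i k : ℕ, 1 ≤ i ∧ i ≤ (N + 1) / 2 ∧ 1 ≤ k ∧ β ^ k * t = i * c := by
  obtain ⟨l, μ, a, hμ, hsub, hcover⟩ :=
    hK.exists_pos_ratio fun x hx => h.sub_mem_union_translate hx
  have hnonneg : ∀ x ∈ Γ ∪ (fun x => x + t) '' Γ, 0 ≤ x := by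
    intro x hx
    rcases mem_union_translate.1 hx with hx | hx
    · exact (h.subset_Icc hx).1
    · linarith [(h.subset_Icc hx).1]
  obtain ⟨q, d, hd, hq⟩ : ∃ (q : ℕ) (d : ℕ → ℕ), (∀ k, d k ≤ N) ∧
      β ^ q * t = digitSum β c d q := by
    obtain ⟨i, y, hy, hy0⟩ := hcover 0 (Or.inl h.zero_mem)
    have h1 := hnonneg _ (hsub i 0 (Or.inl h.zero_mem))
    have h2 := mul_nonneg (hμ i).1.le (hnonneg y hy)
    have h3 : a i = 0 := by linarith
    exact h.exists_expansion ht (hμ i).1 (hμ i).2 fun x hx => by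
      simpa [h3] using hsub i x hx
  have hroom : ∀ x : ℕ → ℕ, (∀ k, x k ≤ N) → _ :=
    fun x hx => h.exists_room hβ ht hd hq hμ hsub hcover hx
  obtain ⟨r, hr, hdr⟩ := h.exists_digit_ne_zero ht hq
  have hpair : ∀ r < q, ∀ r' < q, d r ≠ 0 → d r' ≠ 0 → ¬ r < r' := by
    intro r hr r' hr' hdr hdr' hlt
    -- Alternating blocks of `0` and `N` of length `r' - r`: the two nonzero digits of `d` face a
    -- `0` and an `N`, so neither adding nor subtracting is possible.
    obtain ⟨n, h1, h2⟩ := hroom (fun k => N * (k / (r' - r) % 2)) fun k =>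
      (Nat.mul_le_mul_left N (Nat.le_of_lt_succ (Nat.mod_lt _ two_pos))).trans_eq (mul_one N)
    have h3 := h1 r hr hdr
    have h4 : n + r' - q = (n + r - q) + (r' - r) := by omega
    have h5 : (n + r' - q) / (r' - r) = (n + r - q) / (r' - r) + 1 := by
      rw [h4, Nat.add_div_right _ (by omega)]
    rcases h2 with h2 | h2
    · have e1 := h2 r hr hdr
      have e2 := h2 r' hr' hdr'
      simp only [h5] at e1 e2
      rcases Nat.mod_two_eq_zero_or_one ((n + r - q) / (r' - r)) with e | e
      · rw [Nat.add_mod, e] at e2; simp at e2; omega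
      · rw [e] at e1; omega
    · have e1 := h2 r hr hdr
      have e2 := h2 r' hr' hdr'
      simp only [h5] at e1 e2
      rcases Nat.mod_two_eq_zero_or_one ((n + r - q) / (r' - r)) with e | e
      · rw [e] at e1; omega
      · rw [Nat.add_mod, e] at e2; simp at e2; omega
  have hzero : ∀ k < q, k ≠ r → d k = 0 := by
    intro k hk hkr
    by_contra hdk
    rcases lt_or_gt_of_ne hkr with hlt | hlt
    · exact hpair k hk r hr hdk hdr hlt
    · exact hpair r hr k hk hdr hdk hlt
  refine ⟨d r, q - r, Nat.one_le_iff_ne_zero.2 hdr, ?_, by omega, ?_⟩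
  -- A constant string just too small for subtraction; adding forces `2 d r - 1 ≤ N`.
  · obtain ⟨n, -, h2⟩ := hroom (fun _ => d r - 1) fun _ => (Nat.sub_le _ _).trans (hd r)
    rcases h2 with h2 | h2
    · have := h2 r hr hdr
      simp only at this
      omega
    · have := h2 r hr hdr
      simp only at this
      omega
  · rw [digitSum_single β c d hr hzero] at hq
    have hp : β ^ r ≠ 0 := (pow_pos h.pos r).ne'
    refine mul_left_cancel₀ hp ?_
    rw [← mul_assoc, ← pow_add, Nat.add_sub_cancel' hr.le, hq]
    ring

theorem isSelfSimilarSet_of_eq (h : IsDigitCantorSet N β c Γ) {i k : ℕ} (hi : i ≤ (N + 1) / 2)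
    (hk : 1 ≤ k) (ht : β ^ k * t = i * c) : IsSelfSimilarSet (Γ ∪ (fun x => x + t) '' Γ) := by
  obtain ⟨k, rfl⟩ : ∃ m, k = m + 1 := ⟨k - 1, by omega⟩
  let D : Set ℝ := {a : ℝ | ∃ d : ℕ → ℕ, (∀ j, d j ≤ N) ∧ a = digitSum β c d (k + 1)}
  have hDfin : D.Finite := finite_digitSum β c N (k + 1)
  -- changing the leading digit by `i` shifts a string by `β ^ (k + 1) * t`
  have hlead : ∀ d e : ℕ → ℕ, (∀ j, d (j + 1) = e (j + 1)) → e 0 = d 0 + i →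
      digitSum β c e (k + 1) = digitSum β c d (k + 1) + β ^ (k + 1) * t := by
    intro d e h1 h2
    rw [digitSum_succ_left, digitSum_succ_left, h2, ht]
    simp only [h1]
    push_cast
    ring
  have hcopy : ∀ d : ℕ → ℕ, (∀ j, d j ≤ N) → d 0 + i ≤ N → ∀ x ∈ Γ ∪ (fun x => x + t) '' Γ,
      β ^ (k + 1) * x + digitSum β c d (k + 1) ∈ Γ := by
    intro d hd h0 x hx
    rcases mem_union_translate.1 hx with hx | hx
    · rw [add_comm]
      exact h.digitSum_add_mem (fun j _ => hd j) hx
    · have := h.digitSum_add_mem (d := fun j => Nat.casesOn j (d 0 + i) fun j => d (j + 1))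
        (n := k + 1) (fun j _ => by
          cases j
          · exact h0
          · exact hd _) hx
      rw [hlead d (fun j => Nat.casesOn j (d 0 + i) fun j => d (j + 1)) (fun _ => rfl) rfl] at this
      convert this using 1
      ring
  have hcov : ∀ x ∈ Γ, ∃ d : ℕ → ℕ, (∀ j, d j ≤ N) ∧ d 0 + i ≤ N ∧
      ∃ y ∈ Γ ∪ (fun x => x + t) '' Γ, x = β ^ (k + 1) * y + digitSum β c d (k + 1) := by
    intro x hx
    obtain ⟨d, hd, y, hy, rfl⟩ := h.exists_digitSum (k + 1) hx
    rcases le_or_gt (d 0 + i) N with h0 | h0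
    · exact ⟨d, hd, h0, y, Or.inl hy, add_comm _ _⟩
    -- Here `d 0 ≥ N + 1 - i ≥ i` by the bound on `i`, so the subtraction is not truncated.
    · refine ⟨fun j => Nat.casesOn j (d 0 - i) fun j => d (j + 1), fun j => ?_, ?_, y + t,
        Or.inr ⟨y, hy, rfl⟩, ?_⟩
      · cases j
        · exact (Nat.sub_le _ _).trans (hd 0)
        · exact hd _
      · have := hd 0
        change d 0 - i + i ≤ N
        omega
      · rw [hlead (fun j => Nat.casesOn j (d 0 - i) fun j => d (j + 1)) d (fun _ => rfl)
          (show d 0 = d 0 - i + i by omega)]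
        ring
  refine isSelfSimilarSet_of_finite (h.nonempty.inl)
    (h.compact.union (h.compact.image (by fun_prop))) (pow_pos h.pos (k + 1))
    (pow_lt_one₀ h.pos.le h.lt_one (Nat.succ_ne_zero k))
    -- Invariance is built into `T`, which leaves only the covering to prove.
    (T := {a ∈ D ∪ (fun x => x + t) '' D | ∀ x ∈ Γ ∪ (fun x => x + t) '' Γ,
      β ^ (k + 1) * x + a ∈ Γ ∪ (fun x => x + t) '' Γ})
    ((hDfin.union (hDfin.image _)).subset (Set.sep_subset _ _)) (fun a ha => ha.2) ?_
  intro x hx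
  rcases mem_union_translate.1 hx with hx | hx
  · obtain ⟨d, hd, h0, y, hy, hxy⟩ := hcov x hx
    exact ⟨_, ⟨Or.inl ⟨d, hd, rfl⟩, fun z hz => Or.inl (hcopy d hd h0 z hz)⟩, y, hy, hxy⟩
  · obtain ⟨d, hd, h0, y, hy, hxy⟩ := hcov _ hx
    refine ⟨_, ⟨Or.inr ⟨_, ⟨d, hd, rfl⟩, rfl⟩, fun z hz =>
      Or.inr ⟨_, hcopy d hd h0 z hz, add_assoc _ _ _⟩⟩, y, hy, ?_⟩
    linarith

end IsDigitCantorSet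

theorem corollary1p3 (N : ℕ) (hN : 1 ≤ N) (β : ℝ) (hβ : β ∈ uniqueDigitSet N)
    (Γ : Set ℝ) (hΓ : IsAttractor (phi N β) Γ) (t : ℝ) (ht : 0 < t) :
    IsSelfSimilarSet (Γ ∪ (fun x => x + t) '' Γ) ↔
      ∃ i k : ℕ, 1 ≤ i ∧ i ≤ (N + 1) / 2 ∧ 1 ≤ k ∧
        t = (i : ℝ) * (1 - β) / (N : ℝ) * β ^ (-(k : ℤ)) := by
  have h := hΓ.isDigitCantorSet hN hβ.1 hβ.2.1
  have key : ∀ i k : ℕ, t = (i : ℝ) * (1 - β) / (N : ℝ) * β ^ (-(k : ℤ)) ↔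
      β ^ k * t = i * ((1 - β) / N) := by
    intro i k
    rw [zpow_neg, zpow_natCast, ← div_eq_mul_inv, eq_div_iff (pow_pos h.pos k).ne', mul_comm t,
      mul_div_assoc]
  simp only [key]
  constructor
  · exact h.eq_of_isSelfSimilarSet hβ ht
  · rintro ⟨i, k, -, hi, hk, hik⟩
    exact h.isSelfSimilarSet_of_eq hi hk hik
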